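/- A category $\mathcal C$ is called parabelian if it is pointed (has a zero object), every morphism has a kernel and a cokernel, strict epimorphisms are closed under pullbacks along strict monomorphisms, and strict monomorphisms are closed under pushouts along strict epimorphisms. Here a pair $X\xrightarrow{f}Y\xrightarrow{g}Z$ is called exact if $f=\ker g$ and $g=\operatorname{coker} f$; a strict monomorphism (resp. strict epimorphism) is a morphism that occurs as $f$ (resp. as $g$) in an exact pair. Let $K$ be a complete valued field, i.e. a field with a map $|\cdot|\colon K\to\mathbb R_{\ge 0}$ satisfying $|x|=0\iff x=0$, $|xy|=|x||y|$, $|x+y|\le|x|+|y|$, which is complete for the metric $|x-y|$ (the trivial valuation is allowed). Let $\mathcal O_K=\{x\in K : |x|\le 1\}$, and let the valuation monad $\bar{\mathcal O}_K$ be the finitary monad on sets with $$\bar{\mathcal O}_K(n)=\Bigl\{t\in K^n : \sum_{i=1}^n t_ix_i\in\mathcal O_K \text{ for all } x\in\mathcal O_K^n\Bigr\},\qquad n\ge 0,$$ a submonad of the monad $X\mapsto K^{(X)}$ of formal $K$-linear combinations. Let $\mathrm{Mod}(\mathcal O_K)$ be the category of (Eilenberg–Moore) algebras over $\bar{\mathcal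 O}_K$. **Theorem.** For every complete valued field $K$, the category $\mathrm{Mod}(\mathcal O_K)$ is parabelian. In particular, the category of absolutely convex spaces (modules over $\mathbb Z_\infty=[-1,1]\subset\mathbb R$), i.e. of algebras over the monad $X\mapsto\{t\in\mathbb R^{(X)} : \sum_{x}|t_x|\le 1\}$, is parabelian. -/

import Mathlib

universe v u w

namespace Parabelian

open CategoryTheory CategoryTheory.Limits

/-! ### Parabelian categories -/

section Categories

variable {C : Type u} [Category.{v} C] [HasZeroMorphisms C]

/-- `X ⟶ Y ⟶ Z` is a short exact sequence: `f` is a kernel of `g` and `g` is a cokernel of `f`. -/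
def IsExactPair {X Y Z : C} (f : X ⟶ Y) (g : Y ⟶ Z) : Prop :=
  ∃ w : f ≫ g = 0,
    Nonempty (IsLimit (KernelFork.ofι f w)) ∧ Nonempty (IsColimit (CokernelCofork.ofπ g w))

/-- A strict monomorphism: the first map of some short exact sequence. -/
def IsStrictMono {X Y : C} (f : X ⟶ Y) : Prop :=
  ∃ (Z : C) (g : Y ⟶ Z), IsExactPair f g

/-- A strict epimorphism: the second map of some short exact sequence. -/
def IsStrictEpi {Y Z : C} (g : Y ⟶ Z) : Prop :=
  ∃ (X : C) (f : X ⟶ Y), IsExactPair f g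

end Categories

/-- The axioms of a parabelian category, for a category with given zero morphisms. -/
structure ParabelianAxioms (C : Type u) [Category.{v} C] [HasZeroMorphisms C] : Prop where
  hasZeroObject : HasZeroObject C
  hasKernels : HasKernels C
  hasCokernels : HasCokernels C
  /-- Strict epimorphisms are closed under pullbacks along strict monomorphisms. -/
  strictEpi_pullback : ∀ {X Y Y' : C} (f : X ⟶ Y) (g : Y' ⟶ Y), IsStrictEpi f → IsStrictMono g →
    ∃ (X' : C) (f' : X' ⟶ Y') (g' : X' ⟶ X), IsPullback f' g' g f ∧ IsStrictEpi f'
  /-- Strict monomorphisms are closed under pushouts along strict epimorphisms. -/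
  strictMono_pushout : ∀ {X X' Y' : C} (f : X' ⟶ Y') (g : X' ⟶ X), IsStrictMono f → IsStrictEpi g →
    ∃ (Y : C) (f' : X ⟶ Y) (g' : Y' ⟶ Y), IsPushout f g g' f' ∧ IsStrictMono f'

/-- A category is parabelian if it is pointed (it has a zero object, hence a unique family of zero
morphisms), has kernels and cokernels, strict epimorphisms are closed under pullbacks along strict
monomorphisms, and strict monomorphisms are closed under pushouts along strict epimorphisms. -/
def IsParabelian (C : Type u) [Category.{v} C] : Prop :=
  ∃ _ : HasZeroMorphisms C, ParabelianAxioms C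

/-! ### Submonads of the free module monad -/

/-- A submonad of the monad `X ↦ (X →₀ A)` of formal `A`-linear combinations: a family of subsets
containing the basis vectors and closed under substitution. -/
structure LinSubmonad (A : Type u) [Semiring A] where
  carrier : ∀ X : Type w, Set (X →₀ A)
  single_mem : ∀ {X : Type w} (x : X), Finsupp.single x 1 ∈ carrier X
  sum_mem : ∀ {X Y : Type w} (s : X →₀ A) (t : X → Y →₀ A), s ∈ carrier X →
    (∀ x, t x ∈ carrier Y) → (s.sum fun x a => a • t x) ∈ carrier Y

namespace LinSubmonad

variable {A : Type u} [Semiring A]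

lemma mapDomain_mem (P : LinSubmonad.{u, w} A) {X Y : Type w} (f : X → Y) {s : X →₀ A}
    (hs : s ∈ P.carrier X) : s.mapDomain f ∈ P.carrier Y := by
  have h := P.sum_mem s (fun x => Finsupp.single (f x) 1) hs (fun x => P.single_mem _)
  simpa [Finsupp.mapDomain] using h

/-- The functor part of the monad: `X ↦ P(X)`, with pushforward of formal combinations. -/
noncomputable def functor (P : LinSubmonad.{u, max u w} A) :
    Type (max u w) ⥤ Type (max u w) where
  obj X := P.carrier X
  map f := TypeCat.ofHom fun s => ⟨s.1.mapDomain f, P.mapDomain_mem f s.2⟩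
  map_id X := ConcreteCategory.hom_ext _ _ fun s => Subtype.ext Finsupp.mapDomain_id
  map_comp f g := ConcreteCategory.hom_ext _ _ fun s => Subtype.ext <| by
    change s.1.mapDomain (g ∘ f) = (s.1.mapDomain f).mapDomain g
    exact Finsupp.mapDomain_comp

/-- The multiplication: `∑ aᵢ [tᵢ] ↦ ∑ aᵢ tᵢ`. -/
noncomputable def join (P : LinSubmonad.{u, w} A) {X : Type w} (s : P.carrier X →₀ A) : X →₀ A :=
  s.sum fun t a => a • t.1

lemma join_mapDomain (P : LinSubmonad.{u, w} A) {X : Type w} {Z : Type*} (f : Z → P.carrier X)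
    (s : Z →₀ A) : P.join (s.mapDomain f) = s.sum fun z a => a • (f z).1 := by
  unfold join
  exact Finsupp.sum_mapDomain_index (fun _ => zero_smul _ _) (fun _ _ _ => add_smul _ _ _)

lemma mapDomain_join (P : LinSubmonad.{u, w} A) {X Y : Type w} (f : X → Y)
    (s : P.carrier X →₀ A) :
    (P.join s).mapDomain f = s.sum fun t a => a • t.1.mapDomain f := by
  unfold join
  simp [Finsupp.sum, Finsupp.mapDomain_finsetSum, Finsupp.mapDomain_smul]

lemma join_mem (P : LinSubmonad.{u, max u w} A) {X : Type (max u w)} {s : P.carrier X →₀ A}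
    (hs : s ∈ P.carrier (P.carrier X)) : P.join s ∈ P.carrier X :=
  P.sum_mem s (fun t : P.carrier X => t.1) hs (fun t => t.2)

lemma join_join (P : LinSubmonad.{u, max u w} A) {X : Type (max u w)}
    (s : P.carrier (P.carrier X) →₀ A) :
    (s.sum fun z a => a • P.join z.1) = P.join (P.join s) := by
  have h : P.join s = s.sum fun t a => a • t.1 := rfl
  rw [h]
  unfold join
  rw [Finsupp.sum_sum_index (h := fun (t : P.carrier X) (a : A) => a • t.1)
    (fun _ => zero_smul _ _) (fun _ _ _ => add_smul _ _ _)]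
  refine Finsupp.sum_congr fun t _ => ?_
  rw [Finsupp.sum_smul_index (h := fun (t : P.carrier X) (a : A) => a • t.1)
    (fun _ => zero_smul _ _), Finsupp.smul_sum]
  simp only [mul_smul]

/-- The monad on sets given by `P`: the unit sends `x` to the basis vector `[x]`, the
multiplication is `∑ aᵢ [tᵢ] ↦ ∑ aᵢ tᵢ`. -/
noncomputable def monad (P : LinSubmonad.{u, max u w} A) : Monad (Type (max u w)) where
  toFunctor := functor.{u, w} P
  η :=
    { app := fun X => TypeCat.ofHom (Y := P.carrier X) fun x =>
        ⟨Finsupp.single x 1, P.single_mem x⟩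
      naturality := fun X Y f => ConcreteCategory.hom_ext _ _ fun x =>
        Subtype.ext (Finsupp.mapDomain_single (f := f) (a := x) (b := (1 : A))).symm }
  μ :=
    { app := fun X => TypeCat.ofHom (X := P.carrier (P.carrier X)) (Y := P.carrier X) fun s =>
        ⟨P.join s.1, join_mem.{u, w} P s.2⟩
      naturality := fun X Y f => ConcreteCategory.hom_ext _ _
        fun s : P.carrier (P.carrier X) => Subtype.ext
          ((P.join_mapDomain (fun t : P.carrier X =>
            (⟨t.1.mapDomain f, P.mapDomain_mem f t.2⟩ : P.carrier Y)) s.1).trans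
            (P.mapDomain_join f s.1).symm) }
  assoc X := ConcreteCategory.hom_ext _ _
    fun s : P.carrier (P.carrier (P.carrier X)) => Subtype.ext
      ((P.join_mapDomain (fun t : P.carrier (P.carrier X) =>
        (⟨P.join t.1, join_mem.{u, w} P t.2⟩ : P.carrier X)) s.1).trans (join_join.{u, w} P s.1))
  left_unit X := ConcreteCategory.hom_ext _ _ fun s : P.carrier X => Subtype.ext <| by
    change P.join (Finsupp.single s 1) = s.1
    simp [join]
  right_unit X := ConcreteCategory.hom_ext _ _ fun s : P.carrier X => Subtype.ext <| by
    refine (P.join_mapDomain (fun x : X =>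
      (⟨Finsupp.single x 1, P.single_mem x⟩ : P.carrier X)) s.1).trans ?_
    change (s.1.sum fun x a => a • Finsupp.single x 1) = s.1
    simp

end LinSubmonad

/-! ### The valuation monad and the monad of absolutely convex spaces -/

/-- The valuation monad of a normed field `K`, as a submonad of the free vector space monad:
`T(X)` is the set of formal combinations `∑ tᵢ [i]` such that `∑ tᵢ xᵢ` lies in the closed unit
ball `𝒪_K = {a | ‖a‖ ≤ 1}` for every family `x` of elements of `𝒪_K`. For `X = {1, …, n}` this is
`{t ∈ Kⁿ | t(𝒪_Kⁿ) ⊆ 𝒪_K}`, and `T` is finitary. -/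
def valuationSubmonad (K : Type u) [NormedField K] : LinSubmonad.{u, w} K where
  carrier X := {t | ∀ x : X → K, (∀ i, ‖x i‖ ≤ 1) → ‖t.sum fun i a => a * x i‖ ≤ 1}
  single_mem x y hy := by simpa using hy x
  sum_mem s t hs ht x hx := by
    rw [Finsupp.sum_sum_index (fun _ => zero_mul _) (fun _ _ _ => add_mul _ _ _)]
    have h : (s.sum fun i a => (a • t i).sum fun j b => b * x j) =
        s.sum fun i a => a * (t i).sum fun j b => b * x j := by
      refine Finsupp.sum_congr fun i _ => ?_
      rw [Finsupp.sum_smul_index (fun _ => zero_mul _), Finsupp.mul_sum]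
      simp only [mul_assoc]
    rw [h]
    exact hs _ fun i => ht i x hx

/-- The valuation monad of a normed field `K`, on the category of sets. -/
noncomputable def valuationMonad (K : Type u) [NormedField K] : Monad (Type (max u w)) :=
  LinSubmonad.monad.{u, w} (valuationSubmonad.{u, max u w} K)

/-- `Mod(𝒪_K)`: the category of (Eilenberg–Moore) algebras over the valuation monad of `K`. -/
abbrev ModO (K : Type u) [NormedField K] := (valuationMonad.{u, w} K).Algebra

/-- The monad `X ↦ {t ∈ ℝX | ‖t‖₁ ≤ 1}` of absolutely convex combinations. -/
def absConvexSubmonad : LinSubmonad.{0, w} ℝ where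
  carrier X := {t | (t.sum fun _ a => |a|) ≤ 1}
  single_mem x := by simp
  sum_mem {X Y} s t hs ht := by
    classical
    let U : Finset Y := s.support.biUnion fun i => (t i).support
    have hU : (s.sum fun i a => a • t i).support ⊆ U :=
      Finsupp.support_sum.trans (Finset.biUnion_mono fun i _ => Finsupp.support_smul)
    have hi : ∀ i ∈ s.support, ∑ j ∈ U, |t i j| ≤ 1 := fun i hi => by
      have h : (t i).sum (fun _ a => |a|) = ∑ j ∈ U, |t i j| :=
        Finsupp.sum_of_support_subset _
          (Finset.subset_biUnion_of_mem (fun i => (t i).support) hi) _ fun _ _ => abs_zero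
      exact h ▸ ht i
    change ((s.sum fun i a => a • t i).sum fun _ a => |a|) ≤ 1
    rw [Finsupp.sum_of_support_subset _ hU _ fun _ _ => abs_zero]
    calc ∑ j ∈ U, |(s.sum fun i a => a • t i) j|
        ≤ ∑ j ∈ U, ∑ i ∈ s.support, |s i| * |t i j| := by
          refine Finset.sum_le_sum fun j _ => ?_
          rw [Finsupp.sum_apply]
          refine (Finset.abs_sum_le_sum_abs _ _).trans_eq (Finset.sum_congr rfl fun i _ => ?_)
          simp [abs_mul]
      _ = ∑ i ∈ s.support, |s i| * ∑ j ∈ U, |t i j| := by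
          rw [Finset.sum_comm]
          simp only [Finset.mul_sum]
      _ ≤ ∑ i ∈ s.support, |s i| :=
          Finset.sum_le_sum fun i h => mul_le_of_le_one_right (abs_nonneg _) (hi i h)
      _ ≤ 1 := hs

/-- The category of absolutely convex spaces (modules over `ℤ_∞ = [-1, 1]`): algebras over the
monad of absolutely convex combinations. -/
abbrev AbsConvexSpace := (LinSubmonad.monad.{0, w} absConvexSubmonad.{w}).Algebra

end Parabelian

namespace Parabelian

open CategoryTheory CategoryTheory.Limits

/-! ### Linear combinations in algebras over a submonad of the free module monad -/

/-! Kernels and cokernels exist for algebras over any pointed submonad: the kernel is the zero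
fibre, and the cokernel is the quotient by the congruence `Cong S` generated by collapsing the image
`S` to zero. Strict monomorphisms are then the zero fibres, and strict epimorphisms the surjections
whose fibres are the classes of the congruence generated by collapsing their own zero fibre.

Both closure axioms reduce to one statement: if `X ⊆ Y` is a kernel and `S ⊆ X`, then elements of
`X` that are congruent modulo `S` in `Y` are already congruent in `X`. All members of a chain of
elementary steps that starts in `X` stay in `X`, so single steps suffice (`RestrictsSteps`). Such a
step has the form `a = ∑ (v + w)ⱼ mⱼ`, `b = ∑ vⱼ mⱼ`, with `mⱼ ∈ S` wherever `wⱼ ≠ 0`; the entries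
belonging to `v` may lie outside `X`.

If coefficients are constrained one by one (the ultrametric case), then `a = 1·b + ∑ wⱼ mⱼ` is an
allowed combination inside `X`, and one step is enough. If the constraint is `∑ N(sⱼ) ≤ 1` (the
archimedean case), this combination is too large. It is replaced by two half steps `v + w → v + w/2
→ v`, each with a rescaled base element. Such an element lies in `X` because a combination of total
size less than `1` that is killed by a positive scalar is itself zero (`comb_eq_zero_of_smul`).

A complete valued field falls under one of these cases. If the integers have norm at most `1`, the
norm is ultrametric. Otherwise Ostrowski's theorem and completeness embed `ℝ` in `K`, and a power
`N` of the norm extends the real absolute value, is subadditive, and describes the valuation monad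
as an `ℓ¹` ball. -/

/-- A submonad of the free module monad is pointed if it contains the zero combinations. -/
class LinSubmonad.Pointed {A : Type u} [Semiring A] (P : LinSubmonad.{u, w} A) : Prop where
  zero_mem : ∀ X : Type w, (0 : X →₀ A) ∈ P.carrier X

section Algebras

variable {A : Type u} [Semiring A] {P : LinSubmonad.{u, max u w} A}

/-- The category of algebras over the monad given by `P`. -/
abbrev Alg (P : LinSubmonad.{u, max u w} A) := (LinSubmonad.monad.{u, w} P).Algebra

namespace Alg

/-- The structure map of an algebra, as a function. -/
def str (M : Alg.{u, w} P) (s : P.carrier M.A) : M.A := M.a s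

lemma str_single (M : Alg.{u, w} P) (x : M.A) :
    M.str ⟨Finsupp.single x 1, P.single_mem x⟩ = x :=
  ConcreteCategory.congr_hom M.unit x

lemma str_join (M : Alg.{u, w} P) (s : P.carrier (P.carrier M.A)) :
    M.str ⟨P.join s.1, LinSubmonad.join_mem.{u, w} P s.2⟩ =
      M.str ⟨s.1.mapDomain M.str, P.mapDomain_mem _ s.2⟩ :=
  ConcreteCategory.congr_hom M.assoc s

lemma map_str {M N : Alg.{u, w} P} (f : M ⟶ N) (s : P.carrier M.A) :
    f.f (M.str s) = N.str ⟨s.1.mapDomain f.f, P.mapDomain_mem _ s.2⟩ :=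
  (ConcreteCategory.congr_hom f.h s).symm

/-- An algebra from a structure map. -/
noncomputable def mk' (X : Type (max u w)) (a : P.carrier X → X)
    (unit : ∀ x, a ⟨Finsupp.single x 1, P.single_mem x⟩ = x)
    (assoc : ∀ s : P.carrier (P.carrier X),
      a ⟨P.join s.1, LinSubmonad.join_mem.{u, w} P s.2⟩ =
        a ⟨s.1.mapDomain a, P.mapDomain_mem _ s.2⟩) : Alg.{u, w} P where
  A := X
  a := TypeCat.ofHom (X := P.carrier X) a
  unit := ConcreteCategory.hom_ext _ _ unit
  assoc := ConcreteCategory.hom_ext _ _ assoc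

/-- A homomorphism from a function compatible with the structure maps. -/
def homMk {M N : Alg.{u, w} P} (f : M.A → N.A)
    (h : ∀ s : P.carrier M.A, f (M.str s) = N.str ⟨s.1.mapDomain f, P.mapDomain_mem _ s.2⟩) :
    M ⟶ N where
  f := TypeCat.ofHom f
  h := ConcreteCategory.hom_ext _ _ fun s => (h s).symm


lemma hom_ext {M N : Alg.{u, w} P} {f g : M ⟶ N} (h : ∀ x, f.f x = g.f x) : f = g :=
  Monad.Algebra.Hom.ext' _ _ _ _ (ConcreteCategory.hom_ext _ _ h)

@[simp] lemma comp_apply {M N L : Alg.{u, w} P} (f : M ⟶ N) (g : N ⟶ L) (x : M.A) :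
    (f ≫ g).f x = g.f (f.f x) := rfl

section Comb

variable [P.Pointed] (M : Alg.{u, w} P) {I J : Type (max u w)}

open Classical in
/-- The linear combination `∑ sⱼ mⱼ` in an algebra (with junk value `0` if it is not allowed
by `P`). -/
noncomputable def comb (s : J →₀ A) (m : J → M.A) : M.A :=
  if h : s ∈ P.carrier J then M.str ⟨s.mapDomain m, P.mapDomain_mem m h⟩
  else M.str ⟨0, LinSubmonad.Pointed.zero_mem _⟩

/-- The zero element of an algebra. -/
noncomputable def zero : M.A := M.str ⟨0, LinSubmonad.Pointed.zero_mem _⟩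

variable {M}

lemma comb_eq {s : J →₀ A} (hs : s ∈ P.carrier J) (m : J → M.A) :
    M.comb s m = M.str ⟨s.mapDomain m, P.mapDomain_mem m hs⟩ := dif_pos hs

lemma str_eq_comb (s : P.carrier M.A) : M.str s = M.comb s.1 id := by
  rw [comb_eq s.2]
  congr 1
  exact Subtype.ext Finsupp.mapDomain_id.symm

@[simp] lemma comb_zero (m : J → M.A) : M.comb 0 m = M.zero := by
  rw [comb_eq (LinSubmonad.Pointed.zero_mem _)]
  rfl

@[simp] lemma comb_single (j : J) (m : J → M.A) : M.comb (Finsupp.single j 1) m = m j := by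
  rw [comb_eq (P.single_mem _)]
  refine Eq.trans ?_ (M.str_single (m j))
  congr 1
  exact Subtype.ext Finsupp.mapDomain_single

lemma comb_mapDomain {s : I →₀ A} (hs : s ∈ P.carrier I) (g : I → J) (m : J → M.A) :
    M.comb (s.mapDomain g) m = M.comb s fun i => m (g i) := by
  rw [comb_eq hs, comb_eq (P.mapDomain_mem g hs)]
  congr 1
  exact Subtype.ext Finsupp.mapDomain_comp.symm

lemma comb_comb {s : I →₀ A} {t : I → J →₀ A} (hs : s ∈ P.carrier I)
    (ht : ∀ i, t i ∈ P.carrier J) (m : J → M.A) :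
    M.comb s (fun i => M.comb (t i) m) = M.comb (s.sum fun i a => a • t i) m := by
  rw [comb_eq (P.sum_mem s t hs ht), comb_eq hs]
  let T : I → P.carrier M.A := fun i => ⟨(t i).mapDomain m, P.mapDomain_mem m (ht i)⟩
  have h := M.str_join ⟨s.mapDomain T, P.mapDomain_mem T hs⟩
  have h1 : (fun i => M.comb (t i) m) = fun i => M.str (T i) := by
    funext i
    exact comb_eq (ht i) m
  have h2 : P.join (s.mapDomain T) = (s.sum fun i a => a • t i).mapDomain m := by
    rw [P.join_mapDomain]
    simp [T, Finsupp.sum, Finsupp.mapDomain_finsetSum, Finsupp.mapDomain_smul]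
  have h3 : (s.mapDomain T).mapDomain M.str = s.mapDomain fun i => M.str (T i) :=
    Finsupp.mapDomain_comp.symm
  simp only [h1]
  simp only [h2, h3] at h
  exact h.symm

lemma map_comb {N : Alg.{u, w} P} (f : M ⟶ N) (s : J →₀ A) (m : J → M.A) :
    f.f (M.comb s m) = N.comb s fun j => f.f (m j) := by
  by_cases hs : s ∈ P.carrier J
  · rw [comb_eq hs, comb_eq hs, map_str]
    congr 1
    exact Subtype.ext Finsupp.mapDomain_comp.symm
  · rw [comb, dif_neg hs, comb, dif_neg hs, map_str]
    rfl

@[simp] lemma map_zero {N : Alg.{u, w} P} (f : M ⟶ N) : f.f M.zero = N.zero := by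
  rw [zero, map_str]
  rfl

lemma filter_sum (s : J →₀ A) (p : J → Prop) [DecidablePred p] :
    (s.sum fun j a => a • if p j then Finsupp.single j (1 : A) else 0) = s.filter p := by
  ext j
  simp only [Finsupp.sum_apply, Finsupp.smul_apply, smul_eq_mul]
  rw [Finsupp.filter_apply, Finsupp.sum, Finset.sum_eq_single j]
  · split_ifs <;> simp
  · intro i _ hij
    split_ifs <;> simp [hij]
  · intro h
    simp [Finsupp.notMem_support_iff.1 h]

lemma filter_mem {s : J →₀ A} (hs : s ∈ P.carrier J) (p : J → Prop) [DecidablePred p] :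
    s.filter p ∈ P.carrier J := by
  have h := P.sum_mem s (fun j => if p j then Finsupp.single j (1 : A) else 0) hs fun j => by
    split_ifs
    exacts [P.single_mem j, LinSubmonad.Pointed.zero_mem _]
  rwa [filter_sum] at h

/-- Substituting the empty combination for the basis vectors outside `p` deletes their coefficients;
evaluated by associativity, the same substitution puts zero in those places. -/
lemma comb_filter {s : J →₀ A} (hs : s ∈ P.carrier J) (p : J → Prop) [DecidablePred p]
    (m : J → M.A) (hm : ∀ j, ¬ p j → m j = M.zero) : M.comb (s.filter p) m = M.comb s m := by
  have h := comb_comb (M := M) (t := fun j => if p j then Finsupp.single j (1 : A) else 0) hs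
    (fun j => by
      split_ifs
      exacts [P.single_mem j, LinSubmonad.Pointed.zero_mem _]) m
  rw [filter_sum] at h
  rw [← h]
  congr 1
  funext j
  split_ifs with hj
  · simp
  · simp [hm j hj]

lemma comb_congr {s s' : J →₀ A} (hs : s ∈ P.carrier J) (hs' : s' ∈ P.carrier J)
    {m m' : J → M.A} (hm : ∀ j, s j ≠ 0 → m j = m' j)
    (h : ∀ j, m' j ≠ M.zero → s j = s' j) : M.comb s m = M.comb s' m' := by
  classical
  have h1 : M.comb s m = M.comb s m' := by
    rw [comb_eq hs, comb_eq hs]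
    congr 1
    exact Subtype.ext (Finsupp.mapDomain_congr fun j hj => hm j (Finsupp.mem_support_iff.1 hj))
  rw [h1, ← comb_filter hs (fun j => m' j ≠ M.zero) m' (by simp),
    ← comb_filter hs' (fun j => m' j ≠ M.zero) m' (by simp)]
  congr 1
  ext j
  simp only [Finsupp.filter_apply]
  split_ifs with hj
  exacts [h j hj, rfl]

end Comb

end Alg

end Algebras

section Congruences

variable {A : Type u} [Semiring A] {P : LinSubmonad.{u, max u w} A} [P.Pointed]

namespace Alg

variable {M N : Alg.{u, w} P}

lemma comb_const_zero {J : Type (max u w)} (s : J →₀ A) : M.comb s (fun _ => M.zero) = M.zero := by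
  by_cases hs : s ∈ P.carrier J
  · rw [← comb_zero (M := M) fun _ : J => M.zero]
    exact comb_congr hs (LinSubmonad.Pointed.zero_mem _) (by simp) (by simp)
  · exact dif_neg hs

/-! ### The congruence generated by collapsing a subset to zero -/

/-- `y` arises from a linear combination representing `x` by replacing some of the entries lying in
`S` by zero. -/
def Step (S : Set M.A) (x y : M.A) : Prop :=
  ∃ (J : Type (max u w)) (s : J →₀ A) (_ : s ∈ P.carrier J) (m m' : J → M.A),
    (∀ j, m j = m' j ∨ (m j ∈ S ∧ m' j = M.zero)) ∧ x = M.comb s m ∧ y = M.comb s m'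

/-- The congruence generated by collapsing `S` to zero. -/
def Cong (S : Set M.A) : M.A → M.A → Prop := Relation.EqvGen (Step S)

lemma Step.refl (S : Set M.A) (x : M.A) : Step S x x :=
  ⟨PUnit, Finsupp.single PUnit.unit 1, P.single_mem _, fun _ => x, fun _ => x, by simp, by simp,
    by simp⟩

lemma Step.of_mem {S : Set M.A} {x : M.A} (hx : x ∈ S) : Step S x M.zero :=
  ⟨PUnit, Finsupp.single PUnit.unit 1, P.single_mem _, fun _ => x, fun _ => M.zero, by simp [hx],
    by simp, by simp⟩

/-- Substituting the combinations that witness the individual steps gives a single combination over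
the disjoint union of their index types. -/
lemma Step.comb {S : Set M.A} {I : Type (max u w)} {s : I →₀ A} (hs : s ∈ P.carrier I)
    {m m' : I → M.A} (h : ∀ i, Step S (m i) (m' i)) : Step S (M.comb s m) (M.comb s m') := by
  choose J t ht n n' hn h1 h2 using h
  have ht' : ∀ i, (t i).mapDomain (Sigma.mk i) ∈ P.carrier (Σ i, J i) := fun i =>
    P.mapDomain_mem _ (ht i)
  refine ⟨Σ i, J i, s.sum fun i a => a • (t i).mapDomain (Sigma.mk i),
    P.sum_mem s _ hs ht', fun j => n j.1 j.2, fun j => n' j.1 j.2, fun j => hn j.1 j.2, ?_, ?_⟩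
  · rw [← comb_comb hs ht']
    congr 1
    funext i
    rw [comb_mapDomain (ht i), h1]
  · rw [← comb_comb hs ht']
    congr 1
    funext i
    rw [comb_mapDomain (ht i), h2]

lemma Cong.refl (S : Set M.A) (x : M.A) : Cong S x x := Relation.EqvGen.refl x

lemma Cong.symm {S : Set M.A} {x y : M.A} (h : Cong S x y) : Cong S y x :=
  Relation.EqvGen.symm _ _ h

lemma Cong.trans {S : Set M.A} {x y z : M.A} (h : Cong S x y) (h' : Cong S y z) : Cong S x z :=
  Relation.EqvGen.trans _ _ _ h h'

lemma Step.cong {S : Set M.A} {x y : M.A} (h : Step S x y) : Cong S x y :=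
  Relation.EqvGen.rel _ _ h

lemma Cong.comb_update {S : Set M.A} {I : Type (max u w)} [DecidableEq I] {s : I →₀ A}
    (hs : s ∈ P.carrier I) (m : I → M.A) (i : I) {x y : M.A} (h : Cong S x y) :
    Cong S (M.comb s (Function.update m i x)) (M.comb s (Function.update m i y)) := by
  induction h with
  | rel x y h =>
    refine (Step.comb hs fun j => ?_).cong
    by_cases hj : j = i
    · subst hj
      simpa using h
    · simpa [Function.update_of_ne hj] using Step.refl S (m j)
  | refl x => exact Cong.refl _ _
  | symm x y _ ih => exact ih.symm
  | trans x y z _ _ ih ih' => exact ih.trans ih'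

/-- The chains joining `m i` to `m' i` may have different lengths, so the entries are changed one at
a time; only the finitely many in the support of `s` matter. -/
lemma Cong.comb {S : Set M.A} {I : Type (max u w)} {s : I →₀ A} (hs : s ∈ P.carrier I)
    {m m' : I → M.A} (h : ∀ i, Cong S (m i) (m' i)) : Cong S (M.comb s m) (M.comb s m') := by
  classical
  have key : ∀ F : Finset I,
      Cong S (M.comb s m) (M.comb s fun i => if i ∈ F then m' i else m i) := by
    intro F
    induction F using Finset.induction_on with
    | empty => simpa using Cong.refl S _
    | insert a F ha ih =>
      refine ih.trans ?_
      have h1 := Cong.comb_update hs (fun i => if i ∈ F then m' i else m i) a (h a)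
      convert h1 using 2
      · funext i
        by_cases hi : i = a
        · subst hi
          simp [ha]
        · simp [Function.update_of_ne hi]
      · funext i
        by_cases hi : i = a
        · subst hi
          simp
        · simp [hi]
  refine (key s.support).trans ?_
  rw [comb_congr hs hs (m' := m') _ fun _ _ => rfl]
  · exact Cong.refl _ _
  · intro j hj
    simp [hj]

lemma Cong.map_eq {S : Set M.A} {f : M ⟶ N} (hf : ∀ x ∈ S, f.f x = N.zero) {x y : M.A}
    (h : Cong S x y) : f.f x = f.f y := by
  induction h with
  | rel x y h =>
    obtain ⟨J, s, hs, m, m', hm, rfl, rfl⟩ := h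
    rw [map_comb, map_comb]
    congr 1
    funext j
    rcases hm j with h | ⟨h, h'⟩
    · rw [h]
    · rw [hf _ h, h', map_zero]
  | refl x => rfl
  | symm x y _ ih => exact ih.symm
  | trans x y z _ _ ih ih' => exact ih.trans ih'

/-! ### Quotients and subalgebras -/

/-- The setoid of the congruence generated by collapsing `S` to zero. -/
def congSetoid (S : Set M.A) : Setoid M.A := Relation.EqvGen.setoid (Step S)

lemma mk_comb_out (S : Set M.A) {I : Type (max u w)} {s : I →₀ A} (hs : s ∈ P.carrier I)
    (m : I → M.A) : Quotient.mk (congSetoid S) (M.comb s m) =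
      Quotient.mk (congSetoid S)
        (M.comb s fun i => (Quotient.mk (congSetoid S) (m i)).out) :=
  Quotient.sound (Cong.comb hs fun _ =>
    Cong.symm (Quotient.exact (s := congSetoid S) (Quotient.out_eq _)))

/-- The quotient of an algebra by the congruence generated by collapsing `S` to zero. -/
noncomputable def quot (M : Alg.{u, w} P) (S : Set M.A) : Alg.{u, w} P :=
  mk' (Quotient (congSetoid S)) (fun s => Quotient.mk _ (M.comb s.1 Quotient.out))
    (fun x => by simp)
    (fun s => by
      dsimp only
      rw [comb_mapDomain s.2, ← mk_comb_out S s.2, comb_comb s.2 fun t => t.2]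
      rfl)

/-- The projection to the quotient. -/
noncomputable def quotπ (M : Alg.{u, w} P) (S : Set M.A) : M ⟶ M.quot S :=
  homMk (fun x => Quotient.mk (congSetoid S) x) fun s => by
    change Quotient.mk (congSetoid S) (M.str s) = Quotient.mk (congSetoid S)
      (M.comb (s.1.mapDomain fun x => Quotient.mk (congSetoid S) x) Quotient.out)
    rw [str_eq_comb, mk_comb_out S s.2, comb_mapDomain s.2]
    rfl

lemma quotπ_surjective (S : Set M.A) : Function.Surjective (M.quotπ S).f :=
  Quotient.mk_surjective

lemma quotπ_eq_iff {S : Set M.A} {x y : M.A} :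
    (M.quotπ S).f x = (M.quotπ S).f y ↔ Cong S x y :=
  ⟨fun h => Quotient.exact (s := congSetoid S) h, fun h => Quotient.sound h⟩

lemma quotπ_of_mem {S : Set M.A} {x : M.A} (hx : x ∈ S) :
    (M.quotπ S).f x = (M.quot S).zero := by
  rw [← map_zero (M.quotπ S), quotπ_eq_iff]
  exact (Step.of_mem hx).cong

/-- A homomorphism that is constant on the fibres of a surjection factors through it. -/
lemma exists_desc {Q : Alg.{u, w} P} {q : M ⟶ Q} (hq : Function.Surjective q.f) (f : M ⟶ N)
    (h : ∀ x y, q.f x = q.f y → f.f x = f.f y) : ∃ g : Q ⟶ N, q ≫ g = f := by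
  let r := Function.surjInv hq
  have hr : ∀ z, q.f (r z) = z := Function.surjInv_eq hq
  refine ⟨homMk (fun z => f.f (r z)) fun s => ?_, hom_ext fun x => h _ _ (hr _)⟩
  rw [str_eq_comb, str_eq_comb, comb_mapDomain s.2]
  have h1 : f.f (r (Q.comb s.1 id)) = f.f (M.comb s.1 r) := by
    refine h _ _ ?_
    rw [hr, map_comb]
    congr 1
    funext z
    exact (hr z).symm
  rw [h1, map_comb]
  rfl

/-- A homomorphism whose image lies in the image of an injection factors through it. -/
lemma exists_lift {L : Alg.{u, w} P} {i : L ⟶ N} (hi : Function.Injective i.f) (f : M ⟶ N)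
    (h : ∀ x, f.f x ∈ Set.range i.f) : ∃ g : M ⟶ L, g ≫ i = f := by
  choose g hg using h
  refine ⟨homMk g fun s => hi ?_, hom_ext hg⟩
  rw [hg, str_eq_comb, str_eq_comb, comb_mapDomain s.2, map_comb, map_comb]
  congr 1
  funext x
  exact (hg x).symm

/-- The kernel of a homomorphism. -/
noncomputable def ker (f : M ⟶ N) : Alg.{u, w} P :=
  mk' {x : M.A // f.f x = N.zero}
    (fun s => ⟨M.comb s.1 Subtype.val, by
      rw [map_comb]
      exact (congrArg _ (funext Subtype.prop)).trans (comb_const_zero s.1)⟩)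
    (fun x => Subtype.ext (by simp))
    (fun s => Subtype.ext (by
      dsimp only
      rw [comb_mapDomain s.2, comb_comb s.2 fun t => t.2]
      rfl))

/-- The inclusion of the kernel. -/
noncomputable def kerι (f : M ⟶ N) : ker f ⟶ M :=
  homMk (M := ker f) Subtype.val fun s => by
    change M.comb s.1 Subtype.val = _
    rw [str_eq_comb]
    exact (comb_mapDomain s.2 (Subtype.val : {x : M.A // f.f x = N.zero} → M.A) id).symm

lemma kerι_injective (f : M ⟶ N) : Function.Injective (kerι f).f := Subtype.val_injective

lemma range_kerι (f : M ⟶ N) (x : M.A) : x ∈ Set.range (kerι f).f ↔ f.f x = N.zero :=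
  ⟨fun ⟨y, hy⟩ => hy ▸ y.2, fun h => ⟨⟨x, h⟩, rfl⟩⟩

/-! ### The pointed structure, kernels and cokernels -/

noncomputable instance : HasZeroMorphisms (Alg.{u, w} P) where
  zero M N := ⟨homMk (fun _ => N.zero) fun s => by
    rw [str_eq_comb, comb_mapDomain s.2]
    exact (comb_const_zero s.1).symm⟩
  comp_zero _ _ := rfl
  zero_comp _ _ _ f := hom_ext fun _ => map_zero f

@[simp] lemma zero_apply (x : M.A) : (0 : M ⟶ N).f x = N.zero := rfl

lemma hasZeroObject : HasZeroObject (Alg.{u, w} P) := by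
  let Z : Alg.{u, w} P := mk' PUnit (fun _ => PUnit.unit) (fun _ => rfl) (fun _ => rfl)
  refine ⟨Z, (IsZero.iff_id_eq_zero Z).2 (hom_ext fun x => rfl)⟩

/-- `f` is injective with image the zero fibre of `g`. -/
def IsKer {X Y Z : Alg.{u, w} P} (f : X ⟶ Y) (g : Y ⟶ Z) : Prop :=
  Function.Injective f.f ∧ ∀ y, y ∈ Set.range f.f ↔ g.f y = Z.zero

/-- `g` is surjective with fibres the classes of the congruence generated by collapsing `S`. -/
def IsCoker {Y Z : Alg.{u, w} P} (S : Set Y.A) (g : Y ⟶ Z) : Prop :=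
  Function.Surjective g.f ∧ ∀ x y, g.f x = g.f y ↔ Cong S x y

variable {X Y Z : Alg.{u, w} P}

lemma isKer_kerι (g : Y ⟶ Z) : IsKer (kerι g) g := ⟨kerι_injective g, range_kerι g⟩

lemma isCoker_quotπ (S : Set Y.A) : IsCoker S (Y.quotπ S) :=
  ⟨quotπ_surjective S, fun _ _ => quotπ_eq_iff⟩

lemma IsKer.comp_eq_zero {f : X ⟶ Y} {g : Y ⟶ Z} (h : IsKer f g) : f ≫ g = 0 :=
  hom_ext fun x => (h.2 _).1 ⟨x, rfl⟩

lemma IsKer.isLimit {f : X ⟶ Y} {g : Y ⟶ Z} (h : IsKer f g) (w : f ≫ g = 0) :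
    Nonempty (IsLimit (KernelFork.ofι f w)) := by
  have H : ∀ {W : Alg.{u, w} P} (k : W ⟶ Y), k ≫ g = 0 → ∃ l : W ⟶ X, l ≫ f = k :=
    fun k hk => exists_lift h.1 k fun x => (h.2 _).2 (by rw [← comp_apply, hk, zero_apply])
  choose l hl using @H
  exact ⟨KernelFork.IsLimit.ofι f w (fun k hk => l k hk) (fun k hk => hl k hk)
    fun k hk b hb => hom_ext fun x => h.1 (by rw [← comp_apply, ← comp_apply, hl, hb])⟩

/-- The explicit kernel and the given one are compared by `k` and `l`. Since `k ≫ l = 𝟙 X`, the map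
`k` is injective, and hence so is `f = k ≫ kerι g`. -/
lemma isKer_of_isLimit {f : X ⟶ Y} {g : Y ⟶ Z} {w : f ≫ g = 0}
    (h : IsLimit (KernelFork.ofι f w)) : IsKer f g := by
  obtain ⟨l, hl⟩ := KernelFork.IsLimit.lift' h (kerι g) (isKer_kerι g).comp_eq_zero
  replace hl : l ≫ f = kerι g := hl
  obtain ⟨k, hk⟩ := exists_lift (kerι_injective g) f fun x =>
    (range_kerι g _).2 (by rw [← comp_apply, w, zero_apply])
  have hkl : k ≫ l = 𝟙 X := Fork.IsLimit.hom_ext h (by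
    change (k ≫ l) ≫ f = 𝟙 X ≫ f
    rw [Category.assoc, hl, hk, Category.id_comp])
  have hkl' : ∀ x, l.f (k.f x) = x := fun x => by rw [← comp_apply, hkl]; rfl
  refine ⟨fun x y hxy => ?_, fun y => ⟨?_, fun hy => ?_⟩⟩
  · rw [← hkl' x, ← hkl' y]
    congr 1
    apply kerι_injective g
    rw [← comp_apply, ← comp_apply, hk, hxy]
  · rintro ⟨x, rfl⟩
    rw [← comp_apply, w, zero_apply]
  · obtain ⟨z, rfl⟩ := (range_kerι g y).2 hy
    exact ⟨l.f z, by rw [← comp_apply, hl]⟩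

lemma IsCoker.map_eq_zero {S : Set Y.A} {g : Y ⟶ Z} (h : IsCoker S g) {x : Y.A} (hx : x ∈ S) :
    g.f x = Z.zero := by
  rw [← map_zero g, h.2]
  exact (Step.of_mem hx).cong

lemma IsCoker.exists_desc {S : Set Y.A} {g : Y ⟶ Z} (h : IsCoker S g) {W : Alg.{u, w} P}
    (k : Y ⟶ W) (hk : ∀ x ∈ S, k.f x = W.zero) : ∃ l : Z ⟶ W, g ≫ l = k :=
  Alg.exists_desc h.1 k fun _ _ hxy => Cong.map_eq hk ((h.2 _ _).1 hxy)

lemma IsCoker.isColimit {f : X ⟶ Y} {g : Y ⟶ Z} (h : IsCoker (Set.range f.f) g)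
    (w : f ≫ g = 0) : Nonempty (IsColimit (CokernelCofork.ofπ g w)) := by
  have H : ∀ {W : Alg.{u, w} P} (k : Y ⟶ W), f ≫ k = 0 → ∃ l : Z ⟶ W, g ≫ l = k :=
    fun k hk => h.exists_desc k (by rintro _ ⟨x, rfl⟩; rw [← comp_apply, hk, zero_apply])
  choose l hl using @H
  refine ⟨CokernelCofork.IsColimit.ofπ g w (fun k hk => l k hk) (fun k hk => hl k hk)
    fun k hk b hb => hom_ext fun z => ?_⟩
  obtain ⟨y, rfl⟩ := h.1 z
  rw [← comp_apply, ← comp_apply, hl, hb]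

lemma isCoker_of_isColimit {f : X ⟶ Y} {g : Y ⟶ Z} {w : f ≫ g = 0}
    (h : IsColimit (CokernelCofork.ofπ g w)) : IsCoker (Set.range f.f) g := by
  obtain ⟨d, hd⟩ := CokernelCofork.IsColimit.desc' h (Y.quotπ (Set.range f.f))
    (hom_ext fun x => quotπ_of_mem ⟨x, rfl⟩)
  replace hd : g ≫ d = Y.quotπ (Set.range f.f) := hd
  have hg : ∀ x ∈ Set.range f.f, g.f x = Z.zero := by
    rintro _ ⟨x, rfl⟩
    rw [← comp_apply, w, zero_apply]
  obtain ⟨e, he⟩ := (isCoker_quotπ (Set.range f.f)).exists_desc g hg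
  have hde : d ≫ e = 𝟙 Z := Cofork.IsColimit.hom_ext h (by
    change g ≫ d ≫ e = g ≫ 𝟙 Z
    rw [← Category.assoc, hd, he, Category.comp_id])
  refine ⟨fun z => ?_, fun x y => ⟨fun hxy => ?_, fun hxy => hxy.map_eq hg⟩⟩
  · obtain ⟨y, hy⟩ := quotπ_surjective _ (d.f z)
    refine ⟨y, ?_⟩
    rw [← he, comp_apply, hy, ← comp_apply, hde]
    rfl
  · rw [← quotπ_eq_iff, ← hd, comp_apply, comp_apply, hxy]

lemma hasKernels : HasKernels (Alg.{u, w} P) where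
  has_limit g := by
    obtain ⟨h⟩ := (isKer_kerι g).isLimit (isKer_kerι g).comp_eq_zero
    exact ⟨⟨⟨_, h⟩⟩⟩

lemma hasCokernels : HasCokernels (Alg.{u, w} P) where
  has_colimit f := by
    have h := isCoker_quotπ (Set.range f.f)
    obtain ⟨h⟩ := h.isColimit (hom_ext fun x => h.map_eq_zero ⟨x, rfl⟩)
    exact ⟨⟨⟨_, h⟩⟩⟩

/-- A kernel of `h` is the kernel of its own cokernel, because `h` is constant on the classes of the
congruence collapsing its zero fibre. -/
lemma isStrictMono_iff {f : X ⟶ Y} :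
    IsStrictMono f ↔ ∃ (Z : Alg.{u, w} P) (h : Y ⟶ Z), IsKer f h := by
  constructor
  · rintro ⟨Z, g, w, ⟨h⟩, -⟩
    exact ⟨Z, g, isKer_of_isLimit h⟩
  · rintro ⟨Z, h, hf⟩
    have hq := isCoker_quotπ (Set.range f.f)
    have hfq : IsKer f (Y.quotπ (Set.range f.f)) := by
      refine ⟨hf.1, fun y => ⟨fun hy => hq.map_eq_zero hy, fun hy => ?_⟩⟩
      rw [← map_zero (Y.quotπ _), quotπ_eq_iff] at hy
      rw [hf.2, hy.map_eq fun x hx => (hf.2 x).1 hx, map_zero]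
    exact ⟨_, _, hfq.comp_eq_zero, hfq.isLimit _, hq.isColimit _⟩

lemma isStrictEpi_iff {g : Y ⟶ Z} :
    IsStrictEpi g ↔ IsCoker {y | g.f y = Z.zero} g := by
  constructor
  · rintro ⟨X, f, w, ⟨h⟩, ⟨h'⟩⟩
    have hf := isKer_of_isLimit h
    have : Set.range f.f = {y | g.f y = Z.zero} := Set.ext hf.2
    exact this ▸ isCoker_of_isColimit h'
  · intro h
    have hr : Set.range (kerι g).f = {y | g.f y = Z.zero} := Set.ext (range_kerι g)
    rw [← hr] at h
    exact ⟨_, kerι g, (isKer_kerι g).comp_eq_zero, (isKer_kerι g).isLimit _, h.isColimit _⟩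

end Alg

end Congruences

/-! ### Reduction of the parabelian axioms to restriction of congruences -/

section Criterion

variable {A : Type u} [Semiring A] {P : LinSubmonad.{u, max u w} A} [P.Pointed]

/-- The congruence generated by collapsing a subset of a kernel `X ⊆ Y` to zero restricts from `Y`
to `X`, on elementary steps. -/
def LinSubmonad.RestrictsSteps (P : LinSubmonad.{u, max u w} A) [P.Pointed] : Prop :=
  ∀ {X Y Z : Alg.{u, w} P} (f : X ⟶ Y) (h : Y ⟶ Z), Alg.IsKer f h →
    ∀ (S : Set X.A) (a b : X.A), Alg.Step (f.f '' S) (f.f a) (f.f b) → Alg.Cong S a b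

namespace Alg

variable {X Y Z : Alg.{u, w} P}

/-- The map `h` is constant along a chain of steps in `Y`, since it kills `S`. A chain starting in
the kernel therefore never leaves it, and each step restricts separately. -/
lemma Cong.restrict (hP : LinSubmonad.RestrictsSteps.{u, w} P) {f : X ⟶ Y} {h : Y ⟶ Z}
    (hf : IsKer f h) {S : Set X.A} {a b : X.A} (hab : Cong (f.f '' S) (f.f a) (f.f b)) :
    Cong S a b := by
  have hS : ∀ y ∈ f.f '' S, h.f y = Z.zero := by
    rintro _ ⟨x, -, rfl⟩
    exact (hf.2 _).1 ⟨x, rfl⟩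
  have key : ∀ y z, Cong (f.f '' S) y z → ∀ a b, f.f a = y → f.f b = z → Cong S a b := by
    intro y z hyz
    induction hyz with
    | rel y z hyz =>
      rintro a b rfl rfl
      exact hP f h hf S a b hyz
    | refl y =>
      intro a b ha hb
      rw [hf.1 (ha.trans hb.symm)]
      exact Cong.refl _ _
    | symm y z _ ih => exact fun a b ha hb => (ih b a hb ha).symm
    | trans y z t hyz _ ih ih' =>
      intro a b ha hb
      have hz : h.f z = Z.zero := by
        rw [← Cong.map_eq hS hyz]
        exact (hf.2 _).1 ⟨a, ha⟩
      obtain ⟨c, hc⟩ := (hf.2 z).2 hz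
      exact (ih a c ha hc).trans (ih' c b hc hb)
  exact key _ _ hab a b rfl rfl

/-- The pullback of `f` along a kernel of `h` is the kernel of `f ≫ h`. It contains the whole zero
fibre of `f`, so the congruence describing the fibres of `f` restricts to it. -/
lemma strictEpi_pullback (hP : LinSubmonad.RestrictsSteps.{u, w} P) {Y' : Alg.{u, w} P}
    (f : X ⟶ Y) (g : Y' ⟶ Y) (hf : IsStrictEpi f) (hg : IsStrictMono g) :
    ∃ (X' : Alg.{u, w} P) (f' : X' ⟶ Y') (g' : X' ⟶ X),
      IsPullback f' g' g f ∧ IsStrictEpi f' := by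
  rw [isStrictEpi_iff] at hf
  obtain ⟨Z, h, hg⟩ := isStrictMono_iff.1 hg
  have hι := isKer_kerι (f ≫ h)
  obtain ⟨f', hf'⟩ := exists_lift hg.1 (kerι (f ≫ h) ≫ f) fun x =>
    (hg.2 _).2 ((hι.2 _).1 ⟨x, rfl⟩)
  have hf'' : ∀ x, g.f (f'.f x) = f.f ((kerι (f ≫ h)).f x) := fun x => by
    rw [← comp_apply, hf', comp_apply]
  refine ⟨_, f', kerι (f ≫ h), ⟨⟨hf'⟩, ?_⟩, isStrictEpi_iff.2 ⟨fun y' => ?_, fun a b => ?_⟩⟩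
  · have H : ∀ s : PullbackCone g f, ∃ l : s.pt ⟶ ker (f ≫ h), l ≫ kerι (f ≫ h) = s.snd :=
      fun s => exists_lift hι.1 s.snd fun x => (hι.2 _).2 (by
        rw [comp_apply, ← comp_apply s.snd f, ← s.condition, comp_apply]
        exact (hg.2 _).1 ⟨_, rfl⟩)
    choose l hl using H
    refine ⟨PullbackCone.IsLimit.mk hf' l (fun s => hom_ext fun x => hg.1 ?_) hl
      fun s m _ hm => hom_ext fun x => hι.1 ?_⟩
    · rw [comp_apply, hf'', ← comp_apply (l s), hl, ← comp_apply, ← comp_apply, s.condition]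
    · rw [← comp_apply, ← comp_apply, hl, hm]
  · obtain ⟨x, hx⟩ := hf.1 (g.f y')
    obtain ⟨x', rfl⟩ := (hι.2 x).2 (by rw [comp_apply, hx]; exact (hg.2 _).1 ⟨y', rfl⟩)
    exact ⟨x', hg.1 (by rw [hf'', hx])⟩
  · refine ⟨fun hab => ?_, fun hab => hab.map_eq fun x hx => hx⟩
    refine Cong.restrict hP hι ?_
    have hS : (kerι (f ≫ h)).f '' {y | f'.f y = Y'.zero} = {y | f.f y = Y.zero} := by
      ext x
      constructor
      · rintro ⟨x, hx, rfl⟩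
        change f.f _ = _
        rw [← hf'', hx, map_zero]
      · intro hx
        have hx' : f.f x = Y.zero := hx
        obtain ⟨x', rfl⟩ := (hι.2 x).2 (by rw [comp_apply, hx', map_zero])
        refine ⟨x', hg.1 ?_, rfl⟩
        rw [hf'', hx', map_zero]
    rw [hS, ← hf.2, ← hf'', ← hf'', hab]

/-- The pushout is `Y'` with the image of the zero fibre of `g` collapsed. Restriction of
congruences makes `f'` injective, and the factorization `h'` of `h` has the image of `f'` as zero
fibre. -/
lemma strictMono_pushout (hP : LinSubmonad.RestrictsSteps.{u, w} P) {X' Y' : Alg.{u, w} P}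
    (f : X' ⟶ Y') (g : X' ⟶ X) (hf : IsStrictMono f) (hg : IsStrictEpi g) :
    ∃ (Y : Alg.{u, w} P) (f' : X ⟶ Y) (g' : Y' ⟶ Y),
      IsPushout f g g' f' ∧ IsStrictMono f' := by
  rw [isStrictEpi_iff] at hg
  obtain ⟨Z, h, hf⟩ := isStrictMono_iff.1 hf
  set S : Set X'.A := {x | g.f x = X.zero}
  have hq := isCoker_quotπ (f.f '' S)
  obtain ⟨f', hf'⟩ := hg.exists_desc (f ≫ Y'.quotπ (f.f '' S)) fun x hx =>
    hq.map_eq_zero ⟨x, hx, rfl⟩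
  have hf'' : ∀ x, f'.f (g.f x) = (Y'.quotπ (f.f '' S)).f (f.f x) := fun x => by
    rw [← comp_apply, hf', comp_apply]
  obtain ⟨h', hh'⟩ := hq.exists_desc h (by
    rintro _ ⟨x, -, rfl⟩
    exact (hf.2 _).1 ⟨x, rfl⟩)
  have hh'' : ∀ y, h'.f ((Y'.quotπ (f.f '' S)).f y) = h.f y := fun y => by
    rw [← comp_apply, hh']
  refine ⟨_, f', Y'.quotπ (f.f '' S), ⟨⟨hf'.symm⟩, ?_⟩,
    isStrictMono_iff.2 ⟨Z, h', fun x y hxy => ?_, fun y => ⟨?_, fun hy => ?_⟩⟩⟩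
  · have H : ∀ s : PushoutCocone f g, ∃ l : Y'.quot (f.f '' S) ⟶ s.pt,
        Y'.quotπ (f.f '' S) ≫ l = s.inl := fun s => hq.exists_desc s.inl (by
          rintro _ ⟨x, hx, rfl⟩
          have hx' : g.f x = X.zero := hx
          rw [← comp_apply, s.condition, comp_apply, hx', map_zero])
    choose l hl using H
    refine ⟨PushoutCocone.IsColimit.mk hf'.symm l hl (fun s => hom_ext fun x => ?_)
      fun s m hm _ => hom_ext fun y => ?_⟩
    · obtain ⟨x, rfl⟩ := hg.1 x
      rw [comp_apply, hf'', ← comp_apply, ← comp_apply, ← comp_apply, hl, s.condition]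
    · obtain ⟨y, rfl⟩ := hq.1 y
      rw [← comp_apply, ← comp_apply, hl, hm]
  · obtain ⟨x, rfl⟩ := hg.1 x
    obtain ⟨y, rfl⟩ := hg.1 y
    rw [hf'', hf'', hq.2] at hxy
    exact (hg.2 _ _).2 (Cong.restrict hP hf hxy)
  · rintro ⟨x, rfl⟩
    obtain ⟨x, rfl⟩ := hg.1 x
    rw [hf'', hh'']
    exact (hf.2 _).1 ⟨x, rfl⟩
  · obtain ⟨y, rfl⟩ := hq.1 y
    rw [hh''] at hy
    obtain ⟨x, rfl⟩ := (hf.2 y).2 hy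
    exact ⟨g.f x, hf'' x⟩

end Alg

theorem LinSubmonad.RestrictsSteps.isParabelian (hP : LinSubmonad.RestrictsSteps.{u, w} P) :
    IsParabelian (Alg.{u, w} P) :=
  ⟨inferInstance, Alg.hasZeroObject, Alg.hasKernels, Alg.hasCokernels,
    Alg.strictEpi_pullback hP, Alg.strictMono_pushout hP⟩

end Criterion

/-! ### Splitting a step into a kept and a collapsed part -/

section Splitting

variable {A : Type u} [Semiring A] {P : LinSubmonad.{u, max u w} A} [P.Pointed]

/-- Replacing an entry by zero has the same effect as dropping its coefficient, so a step amounts to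
passing from `s` to `s.filter p`, where `p` marks the unchanged entries. -/
lemma LinSubmonad.restrictsSteps_of
    (H : ∀ {X Y Z : Alg.{u, w} P} (f : X ⟶ Y) (h : Y ⟶ Z), Alg.IsKer f h → ∀ (S : Set X.A)
      (J : Type (max u w)) (s : J →₀ A) (p : J → Prop) [DecidablePred p] (m : J → Y.A)
      (a b : X.A), s ∈ P.carrier J → (∀ j, ¬ p j → m j ∈ f.f '' S) →
      f.f a = Y.comb s m → f.f b = Y.comb (s.filter p) m → Alg.Cong S a b) :
    LinSubmonad.RestrictsSteps.{u, w} P := by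
  classical
  intro X Y Z f h hf S a b hab
  obtain ⟨J, s, hs, m, m', hm, ha, hb⟩ := hab
  refine H f h hf S J s (fun j => m j = m' j) m a b hs
    (fun j hj => ((hm j).resolve_left hj).1) ha ?_
  rw [hb, ← Alg.comb_filter hs (fun j => m j = m' j) m' fun j hj => ((hm j).resolve_left hj).2]
  refine Alg.comb_congr (Alg.filter_mem hs _) (Alg.filter_mem hs _) (fun j hj => ?_)
    fun _ _ => rfl
  by_contra hne
  exact hj (Finsupp.filter_apply_neg _ _ fun h => hne h.symm)

namespace Alg

variable {X Y : Alg.{u, w} P} {J : Type (max u w)}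

lemma sum_single_none_add_mapDomain_some (c : A) (w : J →₀ A) (t : Option J → J →₀ A) :
    ((Finsupp.single none c + w.mapDomain some : Option J →₀ A).sum fun i a => a • t i) =
      c • t none + w.sum fun j a => a • t (some j) := by
  rw [Finsupp.sum_add_index' (h := fun i a => a • t i) (fun _ => zero_smul _ _)
      (fun _ _ _ => add_smul _ _ _),
    Finsupp.sum_single_index (h := fun i a => a • t i) (zero_smul _ _),
    Finsupp.sum_mapDomain_index (h := fun i a => a • t i) (fun _ => zero_smul _ _)
      (fun _ _ _ => add_smul _ _ _)]

lemma comb_option {c : A} {v w : J →₀ A} (hv : v ∈ P.carrier J)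
    (hcw : Finsupp.single none c + w.mapDomain some ∈ P.carrier (Option J)) (m : J → Y.A) :
    Y.comb (Finsupp.single none c + w.mapDomain some) (fun i => i.elim (Y.comb v m) m) =
      Y.comb (c • v + w) m := by
  have h := comb_comb (M := Y) (t := fun i => i.elim v fun j => Finsupp.single j 1) hcw
    (by rintro (_ | j); exacts [hv, P.single_mem j]) m
  convert h using 2
  · funext i
    cases i <;> simp
  · rw [sum_single_none_add_mapDomain_some]
    simp

lemma smul_add_mem {Q : LinSubmonad.{u, max u w} A} {c : A} {v w : J →₀ A} (hv : v ∈ Q.carrier J)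
    (hcw : Finsupp.single none c + w.mapDomain some ∈ Q.carrier (Option J)) :
    c • v + w ∈ Q.carrier J := by
  have h := Q.sum_mem _ (fun i => i.elim v fun j => Finsupp.single j 1) hcw
    (by rintro (_ | j); exacts [hv, Q.single_mem j])
  rw [sum_single_none_add_mapDomain_some] at h
  simpa using h

lemma comb_option_zero {c : A} {v w : J →₀ A} (hv : v ∈ P.carrier J)
    (hcw : Finsupp.single none c + w.mapDomain some ∈ P.carrier (Option J)) (m : J → Y.A) :
    Y.comb (Finsupp.single none c + w.mapDomain some) (fun i => i.elim (Y.comb v m)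
      fun _ => Y.zero) = Y.comb (c • v) m := by
  have h := comb_comb (M := Y) (t := fun i => i.elim v fun j => 0) hcw
    (by rintro (_ | j); exacts [hv, LinSubmonad.Pointed.zero_mem _]) m
  convert h using 2
  · funext i
    cases i <;> simp
  · rw [sum_single_none_add_mapDomain_some]
    simp

/-- The combination `c·[a] + ∑ wⱼ [kⱼ]` has all its relevant entries in `X`, even when the entries
of `v` do not lie there. Collapsing the `kⱼ` gives a step in `X`, and injectivity of `f` identifies
its ends with `x` and `y`. -/
lemma step_of_split {f : X ⟶ Y} (hf : Function.Injective f.f) {S : Set X.A} {c : A}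
    {v w : J →₀ A} (hv : v ∈ P.carrier J)
    (hcw : Finsupp.single none c + w.mapDomain some ∈ P.carrier (Option J)) {m : J → Y.A}
    (hw : ∀ j, w j ≠ 0 → m j ∈ f.f '' S) {a x y : X.A} (ha : f.f a = Y.comb v m)
    (hx : f.f x = Y.comb (c • v + w) m) (hy : f.f y = Y.comb (c • v) m) : Step S x y := by
  classical
  have hw' : ∀ j, ∃ k : X.A, w j ≠ 0 → k ∈ S ∧ f.f k = m j := fun j => by
    by_cases hj : w j = 0
    · exact ⟨a, fun h => absurd hj h⟩
    · obtain ⟨k, hk⟩ := hw j hj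
      exact ⟨k, fun _ => hk⟩
  choose k hk using hw'
  have hval : ∀ j, (Finsupp.single none c + w.mapDomain some : Option J →₀ A) (some j) = w j :=
    fun j => by
      simp [Finsupp.mapDomain_apply (Option.some_injective J)]
  -- Where `w j = 0`, the chosen `k j` need not lie in `S`, so it is left unchanged; its coefficient
  -- vanishes.
  refine ⟨Option J, _, hcw, fun i => i.elim a k,
    fun i => i.elim a fun j => if w j = 0 then k j else X.zero, ?_, hf ?_, hf ?_⟩
  · rintro (_ | j)
    · exact Or.inl rfl
    · by_cases hj : w j = 0
      · simp [hj]
      · exact Or.inr ⟨(hk j hj).1, by simp [hj]⟩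
  · rw [hx, map_comb, ← comb_option hv hcw]
    refine comb_congr hcw hcw (fun i hi => ?_) fun _ _ => rfl
    rcases i with _ | j
    · exact ha.symm
    · rw [hval] at hi
      exact (hk j hi).2.symm
  · rw [hy, map_comb, ← comb_option_zero hv hcw]
    refine comb_congr hcw hcw (fun i hi => ?_) fun _ _ => rfl
    rcases i with _ | j
    · exact ha.symm
    · rw [hval] at hi
      simp [hi]

end Alg

/-- The case of a monad of combinations whose coefficients are only constrained individually, such
as the monad of modules over a ring. -/
theorem LinSubmonad.restrictsSteps_of_forall_mem (B : Set A) (hB : 1 ∈ B)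
    (hP : ∀ (X : Type (max u w)) (s : X →₀ A), s ∈ P.carrier X ↔ ∀ x, s x ∈ B) :
    LinSubmonad.RestrictsSteps.{u, w} P := by
  refine LinSubmonad.restrictsSteps_of fun {X Y Z} f h hf S J s p _ m a b hs hm ha hb => ?_
  have hs1 := Alg.filter_mem hs p
  have hs2 := (hP _ _).1 (Alg.filter_mem hs fun j => ¬ p j)
  refine (Alg.step_of_split hf.1 (c := 1) (w := s.filter fun j => ¬ p j) hs1 ((hP _ _).2 ?_)
    (fun j hj => hm j fun hpj => hj (Finsupp.filter_apply_neg _ _ (not_not.2 hpj))) hb ?_ ?_).cong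
  · rintro (_ | j)
    · rw [Finsupp.add_apply, Finsupp.mapDomain_of_notMem_range _ _ (by simp)]
      simpa using hB
    · rw [Finsupp.add_apply, Finsupp.mapDomain_apply (Option.some_injective J)]
      simpa using hs2 j
  · rw [one_smul, Finsupp.filter_add_filter_not, ha]
  · rw [one_smul, hb]

end Splitting

/-! ### Combinations of total size at most one -/

section Archimedean

variable {K : Type u} [Field K] {P : LinSubmonad.{u, max u w} K}

/-- `P` consists of the combinations `s` with `∑ N (sᵢ) ≤ 1`, for a multiplicative function `N`
which extends the absolute value along an embedding of the real numbers. -/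
structure LinSubmonad.IsUnitBall (P : LinSubmonad.{u, w} K) (ι : ℝ →+* K) (N : K → ℝ) :
    Prop where
  nonneg : ∀ x, 0 ≤ N x
  mul : ∀ x y, N (x * y) = N x * N y
  eq_abs : ∀ r : ℝ, N (ι r) = |r|
  mem_iff : ∀ (X : Type w) (s : X →₀ K), s ∈ P.carrier X ↔ (s.sum fun _ a => N a) ≤ 1

namespace LinSubmonad.IsUnitBall

variable {ι : ℝ →+* K} {N : K → ℝ} {J : Type (max u w)}

lemma map_zero (hP : P.IsUnitBall ι N) : N 0 = 0 := by simpa using hP.eq_abs 0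

lemma sum_nonneg (hP : P.IsUnitBall ι N) (s : J →₀ K) : 0 ≤ s.sum fun _ a => N a :=
  Finset.sum_nonneg fun _ _ => hP.nonneg _

lemma sum_smul (hP : P.IsUnitBall ι N) (r : ℝ) (s : J →₀ K) :
    ((ι r • s).sum fun _ a => N a) = |r| * s.sum fun _ a => N a := by
  rw [Finsupp.sum_smul_index (by simp [hP.map_zero]), Finsupp.mul_sum]
  simp [hP.mul, hP.eq_abs]

lemma sum_smul_filter_add_smul_filter (hP : P.IsUnitBall ι N) (q r : ℝ)
    (s : J →₀ K) (p : J → Prop) [DecidablePred p] :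
    ((ι q • s.filter p + ι r • s.filter fun j => ¬ p j).sum fun _ a => N a) =
      |q| * ((s.filter p).sum fun _ a => N a) +
        |r| * (s.filter fun j => ¬ p j).sum fun _ a => N a := by
  rw [← Finsupp.sum_filter_add_sum_filter_not p, ← hP.sum_smul, ← hP.sum_smul]
  congr 2
  · ext j
    by_cases hj : p j <;> simp [hj]
  · ext j
    by_cases hj : p j <;> simp [hj]

lemma sum_single_add_mapDomain (hP : P.IsUnitBall ι N) (r : ℝ) (s : J →₀ K) :
    ((Finsupp.single none (ι r) + s.mapDomain some : Option J →₀ K).sum fun _ a => N a) =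
      |r| + s.sum fun _ a => N a := by
  classical
  rw [Finsupp.sum_add_index_of_disjoint, Finsupp.sum_single_index hP.map_zero, hP.eq_abs]
  · congr 1
    exact Finsupp.sum_mapDomain_index_inj (h := fun _ a => N a) (Option.some_injective J)
  · rw [Finset.disjoint_left]
    intro i hi
    have := Finsupp.support_single_subset hi
    simp only [Finset.mem_singleton] at this
    subst this
    simp [Finsupp.mapDomain_of_notMem_range]

lemma pointed (hP : P.IsUnitBall ι N) : P.Pointed := ⟨fun X => (hP.mem_iff _ _).2 (by simp)⟩

variable [P.Pointed] {Z : Alg.{u, w} P}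

open Alg

/-- A combination with coefficients of total size less than `1` vanishes if some positive multiple
of it does. -/
lemma comb_eq_zero_of_smul (hP : P.IsUnitBall ι N) {s : J →₀ K}
    (hs : (s.sum fun _ a => N a) < 1) {c : ℝ} (hc : 0 < c)
    (hc1 : c ≤ 1) {z : J → Z.A} (h : Z.comb (ι c • s) z = Z.zero) : Z.comb s z = Z.zero := by
  set σ := s.sum fun _ a => N a
  have hσ : 0 ≤ σ := hP.sum_nonneg s
  have hmem : ∀ γ : ℝ, 0 ≤ γ → γ ≤ 1 → ι γ • s ∈ P.carrier J := fun γ h0 h1 => by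
    rw [hP.mem_iff, hP.sum_smul, abs_of_nonneg h0]
    nlinarith
  -- With `x = ∑ sⱼ zⱼ` and `c x = 0`, evaluate `β (c x) + γ x` in two ways: by substitution it is
  -- `(β c + γ) x`, and since `c x = 0` it is `γ x`. The bound on `β + γ σ` makes the combination
  -- allowed.
  have key : ∀ β γ : ℝ, 0 ≤ β → 0 ≤ γ → γ ≤ 1 → β + γ * σ ≤ 1 →
      Z.comb (ι (β * c + γ) • s) z = Z.comb (ι γ • s) z := by
    intro β γ hβ hγ hγ1 hβγ
    have hcw : Finsupp.single none (ι β) + (ι γ • s).mapDomain some ∈ P.carrier (Option J) := by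
      rw [hP.mem_iff, hP.sum_single_add_mapDomain, hP.sum_smul, abs_of_nonneg hβ,
        abs_of_nonneg hγ]
      exact hβγ
    have h1 := comb_option (hmem c hc.le hc1) hcw z
    have h2 := comb_option (LinSubmonad.Pointed.zero_mem (P := P) J) hcw z
    rw [h] at h1
    rw [comb_zero, h1, smul_zero, zero_add, smul_smul, ← map_mul, ← add_smul, ← map_add] at h2
    exact h2
  -- For every `γ ≤ 1` the choice `β = 1 - σ` is allowed, so a scalar can be lowered by the fixed
  -- amount `ε`; this is where `σ < 1` is needed. Finitely many reductions take `1` to `0`.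
  set ε := (1 - σ) * c with hε
  have hε0 : 0 < ε := mul_pos (by linarith) hc
  have hind : ∀ (n : ℕ) (γ : ℝ), 0 ≤ γ → γ ≤ 1 → γ ≤ n * ε → Z.comb (ι γ • s) z = Z.zero := by
    intro n
    induction n with
    | zero =>
      intro γ h0 _ h2
      have : γ = 0 := le_antisymm (by simpa using h2) h0
      subst this
      simp
    | succ n ih =>
      intro γ h0 h1 h2
      push_cast at h2
      rcases le_total γ ε with hγ | hγ
      · have h3 := key (γ / c) 0 (by positivity) le_rfl zero_le_one (by
          rw [zero_mul, add_zero, div_le_one hc]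
          nlinarith)
        rw [div_mul_cancel₀ _ hc.ne', add_zero] at h3
        rw [h3]
        simp
      · have h3 := key (1 - σ) (γ - ε) (by linarith) (by linarith) (by linarith) (by nlinarith)
        rw [← hε, add_sub_cancel] at h3
        rw [h3]
        exact ih _ (by linarith) (by linarith) (by linarith)
  obtain ⟨n, hn⟩ := exists_nat_ge (1 / ε)
  have := hind n 1 zero_le_one le_rfl (by rwa [div_le_iff₀ hε0] at hn)
  simpa using this

/-- Let `v` and `w` be the kept and the collapsed part, of sizes `β` and `α`. Using `b` with
coefficient `1` leaves no room for `w`, so the base coefficient is lowered to `c < 1`, `w` is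
removed in two halves, and the base elements are `v/c + w/(2c)` and `v/c`. -/
theorem restrictsSteps (hP : P.IsUnitBall ι N) : LinSubmonad.RestrictsSteps.{u, w} P := by
  refine LinSubmonad.restrictsSteps_of fun {X Y Z} f h hf S J s p _ m a b hs hm ha hb => ?_
  set v := s.filter p with hvdef
  set w := s.filter (fun j => ¬ p j) with hwdef
  have hvw : v + w = s := Finsupp.filter_add_filter_not s p
  set β := v.sum fun _ a => N a with hβ
  set α := w.sum fun _ a => N a with hα
  have hβ0 : 0 ≤ β := hP.sum_nonneg v
  have hα0 : 0 ≤ α := hP.sum_nonneg w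
  have hαβ : β + α ≤ 1 := by
    rw [hβ, hα, Finsupp.sum_filter_add_sum_filter_not]
    exact (hP.mem_iff _ _).1 hs
  have hw : ∀ j, w j ≠ 0 → m j ∈ f.f '' S := fun j hj =>
    hm j fun hpj => hj (Finsupp.filter_apply_neg _ _ (not_not.2 hpj))
  rcases hα0.eq_or_lt with hα1 | hα1
  · have hw0 : w = 0 := by
      ext j
      by_contra hj
      have h1 : N (w j) ≤ α := Finset.single_le_sum (f := fun j => N (w j))
        (fun _ _ => hP.nonneg _) (Finsupp.mem_support_iff.2 hj)
      have h2 : N (w j) * N (w j)⁻¹ = 1 := by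
        rw [← hP.mul, mul_inv_cancel₀ hj]
        simpa using hP.eq_abs 1
      rw [le_antisymm (h1.trans hα1.symm.le) (hP.nonneg _), zero_mul] at h2
      exact zero_ne_one h2
    rw [hw0, add_zero] at hvw
    rw [hf.1 (ha.trans (hvw ▸ hb.symm))]
    exact Cong.refl _ _
  -- This choice gives `c + α/2 = 1`, so `c·[·] + w/2` is allowed. Also `β ≤ 1 - α < c`, so `v/c`
  -- has size less than `1`, and `β + α/2 ≤ c`, so `v/c + w/(2c)` is allowed.
  set c : ℝ := 1 - α / 2 with hc
  have hc0 : 0 < c := by linarith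
  have hcc : ι c * ι c⁻¹ = 1 := by rw [← map_mul, mul_inv_cancel₀ hc0.ne', map_one]
  have hcv : ι c • ι c⁻¹ • v = v := by rw [smul_smul, hcc, one_smul]
  have hhalf : ι (1 / 2) • w + ι (1 / 2) • w = w := by
    rw [← add_smul, ← map_add, add_halves, map_one, one_smul]
  -- the two auxiliary combinations
  have hv0sum : ((ι c⁻¹ • v).sum fun _ a => N a) = c⁻¹ * β := by
    rw [hP.sum_smul, abs_of_pos (inv_pos.2 hc0)]
  have hv0lt : c⁻¹ * β < 1 := by
    rw [inv_mul_lt_iff₀ hc0]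
    linarith
  have hv0 : ι c⁻¹ • v ∈ P.carrier J := by
    rw [hP.mem_iff, hv0sum]
    exact hv0lt.le
  have hv1 : ι c⁻¹ • v + ι (c⁻¹ / 2) • w ∈ P.carrier J := by
    rw [hP.mem_iff, hP.sum_smul_filter_add_smul_filter, ← hβ, ← hα,
      abs_of_pos (inv_pos.2 hc0), abs_of_pos (half_pos (inv_pos.2 hc0))]
    have : c⁻¹ * β + c⁻¹ / 2 * α = c⁻¹ * (β + α / 2) := by ring
    rw [this, inv_mul_le_iff₀ hc0]
    linarith
  have hcw : Finsupp.single none (ι c) + (ι (1 / 2) • w).mapDomain some ∈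
      P.carrier (Option J) := by
    rw [hP.mem_iff, hP.sum_single_add_mapDomain, hP.sum_smul, ← hα, abs_of_pos hc0,
      abs_of_pos (by norm_num)]
    linarith
  have hw' : ∀ j, (ι (1 / 2) • w) j ≠ 0 → m j ∈ f.f '' S := fun j hj =>
    hw j fun h0 => hj (by simp [h0])
  have hmz : ∀ j, ¬ p j → h.f (m j) = Z.zero := by
    intro j hj
    obtain ⟨x, -, hx⟩ := hm j hj
    exact (hf.2 _).1 ⟨x, hx⟩
  -- The multiple by `c` is `h (f b) = 0`, and the size is less than `1`, so the combination itself
  -- vanishes in `Z`.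
  have hz0 : h.f (Y.comb (ι c⁻¹ • v) m) = Z.zero := by
    rw [map_comb]
    refine hP.comb_eq_zero_of_smul (hv0sum.trans_lt hv0lt) hc0 (by linarith) ?_
    rw [hcv, ← map_comb, ← hb]
    exact (hf.2 _).1 ⟨b, rfl⟩
  -- Since `h` kills the entries belonging to `w`, only the `v` part contributes.
  have hz1 : h.f (Y.comb (ι c⁻¹ • v + ι (c⁻¹ / 2) • w) m) = Z.zero := by
    rw [← hz0, map_comb, map_comb]
    refine comb_congr hv1 hv0 (fun _ _ => rfl) fun j hj => ?_
    have hpj : p j := by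
      by_contra hpj
      exact hj (hmz j hpj)
    simp [hwdef, hpj]
  obtain ⟨a0, ha0⟩ := (hf.2 _).2 hz0
  obtain ⟨a1, ha1⟩ := (hf.2 _).2 hz1
  have hcv1 : ι c • (ι c⁻¹ • v + ι (c⁻¹ / 2) • w) = v + ι (1 / 2) • w := by
    rw [smul_add, hcv, smul_smul, ← map_mul]
    congr 3
    field_simp
  have hmid : v + ι (1 / 2) • w ∈ P.carrier J := by
    rw [← hcv]
    exact smul_add_mem hv0 hcw
  have hzmid : h.f (Y.comb (v + ι (1 / 2) • w) m) = Z.zero := by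
    have hz : h.f (Y.comb v m) = Z.zero := by
      rw [← hb]
      exact (hf.2 _).1 ⟨b, rfl⟩
    rw [← hz, map_comb, map_comb]
    refine comb_congr hmid (filter_mem hs p) (fun _ _ => rfl) fun j hj => ?_
    have hpj : p j := by
      by_contra hpj
      exact hj (hmz j hpj)
    simp [hvdef, hwdef, hpj]
  obtain ⟨d, hd⟩ := (hf.2 _).2 hzmid
  refine Cong.trans (y := d)
    (step_of_split hf.1 (c := ι c) (w := ι (1 / 2) • w) hv1 hcw hw' ha1 ?_ ?_).cong
    (step_of_split hf.1 (c := ι c) (w := ι (1 / 2) • w) hv0 hcw hw' ha0 ?_ ?_).cong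
  · rw [hcv1, add_assoc, hhalf, hvw, ha]
  · rw [hcv1, hd]
  · rw [hcv, hd]
  · rw [hcv, hb]

end LinSubmonad.IsUnitBall

end Archimedean

end Parabelian

namespace Parabelian

open Filter Topology

/-! ### The unit ball of a complete valued field -/

/-- If `S > R > 0`, the exponential `(S / R) ^ n` would eventually exceed the linear factor `n + 1`.
-/
lemma le_of_forall_pow_le_succ_mul_pow {S R : ℝ} (hR : 0 ≤ R)
    (h : ∀ n : ℕ, S ^ n ≤ (n + 1) * R ^ n) : S ≤ R := by
  by_contra! hlt
  rcases hR.eq_or_lt with rfl | hR0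
  · have := h 1
    simp at this
    linarith
  · have hq : 1 < S / R := (one_lt_div hR0).2 hlt
    have ht := tendsto_pow_const_div_const_pow_of_one_lt 1 hq
    obtain ⟨n, hn, hn1⟩ := ((ht.eventually_lt_const (show (0 : ℝ) < 1 / 2 by norm_num)).and
      (eventually_ge_atTop 1)).exists
    have hpos : 0 < (S / R) ^ n := by positivity
    rw [pow_one, div_lt_iff₀ hpos] at hn
    have h2 : (S / R) ^ n ≤ n + 1 := by
      rw [div_pow, div_le_iff₀ (by positivity)]
      exact h n
    have h3 : (1 : ℝ) ≤ n := by exact_mod_cast hn1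
    linarith

section

variable {K : Type u} [NormedField K]

/-- Testing against the indicator of a point bounds each coefficient; the strong triangle inequality
gives the converse. -/
lemma mem_valuationSubmonad_iff_of_isUltrametricDist [IsUltrametricDist K] {X : Type w}
    (s : X →₀ K) :
    s ∈ (valuationSubmonad.{u, w} K).carrier X ↔ ∀ x, s x ∈ Metric.closedBall (0 : K) 1 := by
  classical
  simp only [mem_closedBall_zero_iff]
  constructor
  · intro hs x
    have h := hs (fun y => if y = x then 1 else 0) fun y => by split_ifs <;> simp
    rw [Finsupp.sum] at h
    simp only [mul_ite, mul_one, mul_zero, Finset.sum_ite_eq'] at h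
    split_ifs at h with hx
    · exact h
    · simp [Finsupp.notMem_support_iff.1 hx]
  · intro hs x hx
    refine IsUltrametricDist.norm_sum_le_of_forall_le_of_nonneg zero_le_one fun i _ => ?_
    rw [norm_mul]
    exact mul_le_one₀ (hs i) (norm_nonneg _) (hx i)

/-- If some `d > 0` vanished in `K`, the naturals would take finitely many values there, while the
norms of the powers of `n` are unbounded. -/
lemma charZero_of_one_lt_norm_natCast {n : ℕ} (hn : 1 < ‖(n : K)‖) : CharZero K := by
  refine charZero_of_inj_zero fun d hd => ?_
  by_contra hd0
  have hper : ∀ k : ℕ, (k : K) = ((k % d : ℕ) : K) := fun k => by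
    conv_lhs => rw [← Nat.mod_add_div k d]
    simp [hd]
  have hbdd : ∀ k : ℕ, ‖(k : K)‖ ≤ ∑ i ∈ Finset.range d, ‖(i : K)‖ := fun k => by
    rw [hper]
    exact Finset.single_le_sum (f := fun i : ℕ => ‖(i : K)‖) (fun _ _ => norm_nonneg _)
      (Finset.mem_range.2 (Nat.mod_lt _ (Nat.pos_of_ne_zero hd0)))
  obtain ⟨k, hk⟩ := pow_unbounded_of_one_lt (∑ i ∈ Finset.range d, ‖(i : K)‖) hn
  have := hbdd (n ^ k)
  rw [Nat.cast_pow, norm_pow] at this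
  linarith

/-- The pullback of the norm along the embedding of the rational numbers. -/
noncomputable def ratAbsoluteValue (K : Type u) [NormedField K] [CharZero K] :
    AbsoluteValue ℚ ℝ where
  toFun q := ‖(q : K)‖
  map_mul' := by simp
  nonneg' := by simp
  eq_zero' := by simp
  add_le' x y := by
    rw [Rat.cast_add]
    exact norm_add_le _ _

lemma exists_rpow_norm_ratCast [CharZero K] {n : ℕ} (hn : 1 < ‖(n : K)‖) :
    ∃ t : ℝ, 0 < t ∧ ∀ q : ℚ, ‖(q : K)‖ ^ t = |(q : ℝ)| := by
  -- Ostrowski: an absolute value on `ℚ` that is unbounded on the integers is equivalent to the real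
  -- one.
  have h : (ratAbsoluteValue K).IsEquiv Rat.AbsoluteValue.real :=
    Rat.AbsoluteValue.equiv_real_of_unbounded fun h => by
      have : ‖((n : ℚ) : K)‖ ≤ 1 := h n
      rw [Rat.cast_natCast] at this
      linarith
  obtain ⟨t, ht, h⟩ := AbsoluteValue.isEquiv_iff_exists_rpow_eq.1 h
  refine ⟨t, ht, fun q => ?_⟩
  have := congrFun h q
  simpa [Rat.AbsoluteValue.real_eq_abs, ratAbsoluteValue] using this

/-- Subadditivity of `N = ‖·‖ ^ t` does not follow from that of the norm when `t > 1`. As `N` takes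
the usual values on binomial coefficients, each term of `(x + y) ^ n` has `N`-value at most `(N x +
N y) ^ n`. There are `n + 1` terms, and the factor `n + 1` disappears on taking `n`-th roots. -/
lemma rpow_norm_add_le [CharZero K] {t : ℝ} (ht : 0 < t)
    (h : ∀ q : ℚ, ‖(q : K)‖ ^ t = |(q : ℝ)|) (x y : K) :
    ‖x + y‖ ^ t ≤ ‖x‖ ^ t + ‖y‖ ^ t := by
  have hN : ∀ z : K, ‖z‖ = (‖z‖ ^ t) ^ t⁻¹ := fun z =>
    (Real.rpow_rpow_inv (norm_nonneg z) ht.ne').symm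
  have hx : 0 ≤ ‖x‖ ^ t := by positivity
  have hy : 0 ≤ ‖y‖ ^ t := by positivity
  set R := (‖x‖ ^ t + ‖y‖ ^ t) ^ t⁻¹ with hR
  have key : ‖x + y‖ ≤ R := by
    refine le_of_forall_pow_le_succ_mul_pow (by positivity) fun n => ?_
    rw [← norm_pow, add_pow]
    refine (norm_sum_le _ _).trans ?_
    have hterm : ∀ i ∈ Finset.range (n + 1), ‖x ^ i * y ^ (n - i) * (n.choose i : K)‖ ≤ R ^ n := by
      intro i hi
      rw [hN, hR, Real.rpow_pow_comm (by positivity)]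
      refine Real.rpow_le_rpow (by positivity) ?_ (by positivity)
      have hc : ‖(n.choose i : K)‖ ^ t = n.choose i := by
        have := h (n.choose i)
        rwa [Rat.cast_natCast, Rat.cast_natCast, Nat.abs_cast] at this
      rw [norm_mul, norm_mul, norm_pow, norm_pow, Real.mul_rpow (by positivity) (by positivity),
        Real.mul_rpow (by positivity) (by positivity), hc, ← Real.rpow_pow_comm (norm_nonneg _),
        ← Real.rpow_pow_comm (norm_nonneg _), add_pow]
      exact Finset.single_le_sum
        (f := fun i => (‖x‖ ^ t) ^ i * (‖y‖ ^ t) ^ (n - i) * (n.choose i : ℝ))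
        (fun _ _ => by positivity) hi
    refine (Finset.sum_le_card_nsmul _ _ _ hterm).trans_eq ?_
    simp
  calc ‖x + y‖ ^ t ≤ R ^ t := Real.rpow_le_rpow (norm_nonneg _) key ht.le
    _ = _ := Real.rpow_inv_rpow (by positivity) ht.ne'

/-- The embedding of the real numbers into a complete archimedean field. -/
lemma exists_ringHom_rpow_norm [CompleteSpace K] [CharZero K] {t : ℝ} (ht : 0 < t)
    (h : ∀ q : ℚ, ‖(q : K)‖ ^ t = |(q : ℝ)|) :
    ∃ ι : ℝ →+* K, ∀ r, ‖ι r‖ ^ t = |r| := by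
  -- Since `‖q‖ = |q| ^ t⁻¹`, the embedding of `ℚ` is continuous at zero, hence uniformly
  -- continuous, and extends to `ℝ` by completeness of `K`.
  have huc : UniformContinuous (Rat.castHom K) := by
    refine uniformContinuous_of_continuousAt_zero (Rat.castHom K) ?_
    rw [ContinuousAt, _root_.map_zero, tendsto_zero_iff_norm_tendsto_zero]
    have h1 : (fun q : ℚ => ‖Rat.castHom K q‖) = fun q : ℚ => |(q : ℝ)| ^ t⁻¹ := by
      funext q
      rw [← h, Real.rpow_rpow_inv (norm_nonneg _) ht.ne']
      rfl
    rw [h1]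
    have hcont : Continuous fun q : ℚ => |(q : ℝ)| ^ t⁻¹ :=
      Continuous.rpow_const Rat.continuous_coe_real.abs fun _ => Or.inr (by positivity)
    convert hcont.tendsto 0
    simp [ht.ne']
  have hi : IsUniformInducing (Rat.castHom ℝ) := Rat.isUniformEmbedding_coe_real.isUniformInducing
  have hd : DenseRange (Rat.castHom ℝ) := Rat.denseRange_cast
  have hc : Continuous (IsDenseInducing.extendRingHom hi hd huc) :=
    (uniformContinuous_uniformly_extend hi hd huc).continuous
  refine ⟨IsDenseInducing.extendRingHom hi hd huc, fun r => ?_⟩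
  refine hd.induction_on (p := fun r => ‖IsDenseInducing.extendRingHom hi hd huc r‖ ^ t = |r|) r
    (isClosed_eq (hc.norm.rpow_const fun _ => Or.inr ht.le) continuous_abs) fun q => ?_
  have : IsDenseInducing.extendRingHom hi hd huc (Rat.castHom ℝ q) = Rat.castHom K q :=
    IsDenseInducing.extend_eq (hi.isDenseInducing hd) huc.continuous q
  rw [this]
  exact h q

lemma exists_isUnitBall_valuationSubmonad [CompleteSpace K] {n : ℕ} (hn : 1 < ‖(n : K)‖) :
    ∃ (ι : ℝ →+* K) (N : K → ℝ), (valuationSubmonad.{u, w} K).IsUnitBall ι N := by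
  have := charZero_of_one_lt_norm_natCast hn
  obtain ⟨t, ht, h⟩ := exists_rpow_norm_ratCast hn
  obtain ⟨ι, hι⟩ := exists_ringHom_rpow_norm ht h
  have hle : ∀ x : K, ‖x‖ ^ t ≤ 1 ↔ ‖x‖ ≤ 1 := fun x => by
    rw [← Real.one_rpow t, Real.rpow_le_rpow_iff (norm_nonneg x) zero_le_one ht]
    simp
  have hmul : ∀ x y : K, ‖x * y‖ ^ t = ‖x‖ ^ t * ‖y‖ ^ t := fun x y => by
    rw [norm_mul, Real.mul_rpow (norm_nonneg x) (norm_nonneg y)]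
  refine ⟨ι, fun x => ‖x‖ ^ t, fun x => by positivity, hmul, hι, fun X s => ⟨fun hs => ?_,
    fun hs x hx => ?_⟩⟩
  · have h1 := hs (fun i => ι (‖s i‖ ^ t) * (s i)⁻¹) fun i => by
      rw [← hle, hmul, hι, abs_of_nonneg (by positivity), ← hmul, hle]
      by_cases hi : s i = 0 <;> simp [hi]
    have h2 : (s.sum fun i a => a * (ι (‖s i‖ ^ t) * (s i)⁻¹)) =
        ι (s.sum fun _ a => ‖a‖ ^ t) := by
      rw [Finsupp.sum, Finsupp.sum, map_sum]
      refine Finset.sum_congr rfl fun i hi => ?_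
      have := Finsupp.mem_support_iff.1 hi
      field_simp
    rw [h2, ← hle, hι] at h1
    exact (le_abs_self _).trans h1
  · rw [← hle]
    have h0 : ∀ F : Finset X, ‖∑ i ∈ F, s i * x i‖ ^ t ≤ ∑ i ∈ F, ‖s i * x i‖ ^ t := fun F =>
      Finset.le_sum_of_subadditive (fun z : K => ‖z‖ ^ t) (by simp [ht.ne'])
        (rpow_norm_add_le ht h) F _
    refine (h0 _).trans (le_trans (Finset.sum_le_sum fun i _ => ?_) hs)
    rw [hmul]
    exact mul_le_of_le_one_right (by positivity) ((hle _).2 (hx i))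

end

/-! ### Conclusion for the two monads -/

lemma isUnitBall_absConvexSubmonad :
    absConvexSubmonad.{w}.IsUnitBall (RingHom.id ℝ) fun x => |x| :=
  ⟨abs_nonneg, abs_mul, fun _ => rfl, fun _ _ => Iff.rfl⟩

theorem isParabelian_modO (K : Type u) [NormedField K] [CompleteSpace K] :
    IsParabelian (ModO.{u, w} K) := by
  by_cases h : ∀ n : ℕ, ‖(n : K)‖ ≤ 1
  · have := IsUltrametricDist.isUltrametricDist_of_forall_norm_natCast_le_one h
    have hP := fun X : Type (max u w) =>
      mem_valuationSubmonad_iff_of_isUltrametricDist (K := K) (X := X)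
    have : (valuationSubmonad.{u, max u w} K).Pointed := ⟨fun X => (hP X _).2 (by simp)⟩
    exact LinSubmonad.RestrictsSteps.isParabelian.{u, w}
      (LinSubmonad.restrictsSteps_of_forall_mem.{u, w} _ (by simp) hP)
  · push Not at h
    obtain ⟨n, hn⟩ := h
    obtain ⟨ι, N, hP⟩ := exists_isUnitBall_valuationSubmonad.{u, max u w} hn
    have := LinSubmonad.IsUnitBall.pointed.{u, w} hP
    exact LinSubmonad.RestrictsSteps.isParabelian.{u, w}
      (LinSubmonad.IsUnitBall.restrictsSteps.{u, w} hP)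

theorem isParabelian_absConvexSpace : IsParabelian AbsConvexSpace.{w} := by
  have := LinSubmonad.IsUnitBall.pointed.{0, w} isUnitBall_absConvexSubmonad.{w}
  exact LinSubmonad.RestrictsSteps.isParabelian.{0, w}
    (LinSubmonad.IsUnitBall.restrictsSteps.{0, w} isUnitBall_absConvexSubmonad.{w})

end Parabelian

theorem mainTheorem11 :
    (∀ (K : Type u) [NormedField K] [CompleteSpace K],
      Parabelian.IsParabelian (Parabelian.ModO.{u, w} K)) ∧
    Parabelian.IsParabelian Parabelian.AbsConvexSpace.{w} :=
  ⟨fun K _ _ => Parabelian.isParabelian_modO.{u, w} K, Parabelian.isParabelian_absConvexSpace.{w}⟩
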